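/- Let $S$ be a closed connected oriented smooth surface, and let $\alpha,\beta$ be smooth simple closed curves on $S$ in minimal position (they are transverse, and the number of points of $\alpha\cap\beta$ is minimal among all pairs of simple closed curves freely homotopic to $\alpha$ and $\beta$ respectively) that fill $S$, i.e. every component of $S\setminus(\alpha\cup\beta)$ is an open disk. Regard $\alpha\cup\beta$ as a graph on $S$ whose vertices are the points of $\alpha\cap\beta$ and whose edges are the arcs of $(\alpha\cup\beta)\setminus(\alpha\cap\beta)$. Its dual graph $G$ is the multigraph whose vertices are the components of $S\setminus(\alpha\cup\beta)$ and which has, for each edge $e$ of $\alpha\cup\beta$, one edge joining the components on the two sides of $e$ (a loop if these coincide). The edges of $G$ at a vertex $P$ are dual to the sides of the polygon $P$, and are cyclically ordered as these sides are around $P$; so two edges of $G$ at $P$ are consecutive if the corresponding sides of $P$ meet at a corner of $P$. A subgraph $H$ of $G$ is called spread if, for every vertex $P$ of $H$, no two edges of $H$ at $P$ are consecutive in the cyclic order at $P$. If $\alpha$ is nonseparating (that is, $S\setminus\alpha$ is connected), then $G$ has a spread spanning tree. If $\alpha$ is separating (that is, $S\setminus\alpha$ is not connected), then $G$ has a spread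 spanning forest with exactly two connected components. -/

import Mathlib

open Set Topology
open scoped Manifold ContDiff Graph

/-! ### Trees and forests in multigraphs -/

namespace Graph

variable {V E : Type*}

/-- The multigraph `G` contains an embedded loop: a closed walk of length `n ≥ 1` whose `n`
vertices are distinct and whose `n` edges are distinct. A loop edge is the case `n = 1`, a pair of
parallel edges the case `n = 2`. -/
def HasEmbeddedLoop (G : Graph V E) : Prop :=
  ∃ (n : ℕ) (x : ℕ → V) (e : ℕ → E), 0 < n ∧ x n = x 0 ∧
    InjOn x (Iio n) ∧ InjOn e (Iio n) ∧ ∀ i < n, G.IsLink (e i) (x i) (x (i + 1))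

/-- A forest is a multigraph without embedded loops. -/
def IsForest (G : Graph V E) : Prop := ¬ G.HasEmbeddedLoop

/-- The connected components of a multigraph, as sets of vertices. -/
def componentSets (G : Graph V E) : Set (Set V) :=
  {C | ∃ x ∈ V(G), C = {y | Relation.ReflTransGen G.Adj x y}}

/-- A tree is a forest that is nonempty and in which any two vertices are joined by a walk. -/
def IsTree (G : Graph V E) : Prop :=
  G.IsForest ∧ V(G).Nonempty ∧ ∀ x ∈ V(G), ∀ y ∈ V(G), Relation.ReflTransGen G.Adj x y

end Graph

/-! ### Curves on surfaces -/

namespace CurvePair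

section Smooth

variable {S : Type*} [TopologicalSpace S] [ChartedSpace (EuclideanSpace ℝ (Fin 2)) S]

/-- A simple closed curve on a smooth surface: a smoothly embedded circle. -/
def IsSimpleClosedCurve (γ : C(Circle, S)) : Prop :=
  Manifold.IsSmoothEmbedding (𝓡 1) (𝓡 2) ∞ γ

/-- The tangent line, in the tangent space of `S` at `γ z`, of the curve `γ` at the parameter `z`.
(Mathlib's tangent spaces at all points of `S` have the same underlying type; lines are only ever
compared below at one and the same point of `S`.) -/
noncomputable def tangentLine (γ : C(Circle, S)) (z : Circle) :
    Submodule ℝ (EuclideanSpace ℝ (Fin 2)) :=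
  LinearMap.range (mfderiv (𝓡 1) (𝓡 2) γ z).toLinearMap

/-- Two curves are transverse: at each intersection point their tangent lines span the tangent
plane of the surface. -/
def Transverse (α β : C(Circle, S)) : Prop :=
  ∀ z w : Circle, α z = β w → tangentLine α z ⊔ tangentLine β w = ⊤

/-- Two simple closed curves are in minimal position: they are transverse, and the number of their
intersection points is minimal among all pairs of simple closed curves that are freely homotopic
to them. -/
def InMinimalPosition (α β : C(Circle, S)) : Prop :=
  Transverse α β ∧
    ∀ α' β' : C(Circle, S), IsSimpleClosedCurve α' → IsSimpleClosedCurve β' →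
      α.Homotopic α' → β.Homotopic β' →
        (range α ∩ range β).encard ≤ (range α' ∩ range β').encard

end Smooth

section Topological

variable {S : Type*} [TopologicalSpace S]

/-- The curve `γ` is nonseparating: its complement is connected. -/
def IsNonseparating (γ : C(Circle, S)) : Prop := IsConnected (range γ)ᶜ

/-- The complementary components of `α ∪ β`. -/
def faces (α β : C(Circle, S)) : Set (Set S) :=
  {P | ∃ x ∈ (range α ∪ range β)ᶜ, P = connectedComponentIn (range α ∪ range β)ᶜ x}

/-- The edges of the graph `α ∪ β` on `S`, whose vertices are the points of `α ∩ β`: the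
(open) arcs into which the intersection points cut the two curves. -/
def edges (α β : C(Circle, S)) : Set (Set S) :=
  {e | ∃ x ∈ (range α ∪ range β) \ (range α ∩ range β),
    e = connectedComponentIn ((range α ∪ range β) \ (range α ∩ range β)) x}

/-- The pair `α, β` is filling: every complementary component of `α ∪ β` is an open disk. -/
def IsFilling (α β : C(Circle, S)) : Prop :=
  ∀ P ∈ faces α β, Nonempty (P ≃ₜ Metric.ball (0 : EuclideanSpace ℝ (Fin 2)) 1)

/-- The dual graph of `α ∪ β`. Its vertices are the complementary components of `α ∪ β`, and each
edge `e` of `α ∪ β` gives one edge of the dual graph, which joins the component on one side of `e`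
to the component on the other side. (If they are the same component, it is a loop.) -/
def dualGraph (α β : C(Circle, S)) : Graph (Set S) (Set S) where
  vertexSet := faces α β
  IsLink e P Q := e ∈ edges α β ∧ P ∈ faces α β ∧ Q ∈ faces α β ∧
    ∀ R ∈ faces α β, e ⊆ closure R ↔ R = P ∨ R = Q
  isLink_symm := fun _ _ ↦ ⟨fun _ _ ⟨h, hP, hQ, hR⟩ ↦
    ⟨h, hQ, hP, fun R hRf ↦ (hR R hRf).trans or_comm⟩⟩
  eq_or_eq_of_isLink_of_isLink := fun _ P _ _ _ h h' ↦
    (h'.2.2.2 P h.2.1).1 ((h.2.2.2 P h.2.1).2 (Or.inl rfl))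
  left_mem_of_isLink := fun _ _ _ h ↦ h.2.1

/-- The edges of the dual graph at the vertex `P` are dual to the sides of the polygon `P`, and
their cyclic order at `P` is the order in which these sides follow each other around `P`. Hence the
edges dual to `e` and `e'` are consecutive at `P` when the sides `e` and `e'` of `P` meet in a
corner of `P`: there are a point `v` of `α ∩ β` and an embedded closed square having `v` as a
corner, whose two sides at `v` run (apart from `v`) in `e` and in `e'`, and the rest of which lies
in `P`. (Being consecutive does not depend on the direction in which one goes around `P`.) -/
def ConsecutiveAt (α β : C(Circle, S)) (P e e' : Set S) : Prop :=
  P ∈ faces α β ∧ e ∈ edges α β ∧ e' ∈ edges α β ∧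
    ∃ ψ : ℝ × ℝ → S, ContinuousOn ψ (Icc 0 1 ×ˢ Icc 0 1) ∧ InjOn ψ (Icc 0 1 ×ˢ Icc 0 1) ∧
      ψ (0, 0) ∈ range α ∩ range β ∧
      (∀ t ∈ Ioc (0 : ℝ) 1, ψ (t, 0) ∈ e) ∧ (∀ t ∈ Ioc (0 : ℝ) 1, ψ (0, t) ∈ e') ∧
      ∀ s ∈ Ioc (0 : ℝ) 1, ∀ t ∈ Ioc (0 : ℝ) 1, ψ (s, t) ∈ P

/-- A subgraph `H` of the dual graph is spread: at every vertex of `H`, no two edges of `H` are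
consecutive in the cyclic order. -/
def IsSpread (α β : C(Circle, S)) (H : Graph (Set S) (Set S)) : Prop :=
  ∀ P ∈ V(H), ∀ e e', H.Inc e P → H.Inc e' P → ¬ ConsecutiveAt α β P e e'

end Topological

end CurvePair

/-!
At a corner of a complementary polygon, an arc of `α` meets an arc of `β`. So no two edges of the
dual graph that are dual to arcs of `β` are ever consecutive, and every subgraph of `dualGraphOver`,
the subgraph of all edges dual to arcs of `β`, is spread. On the other hand, the complement of `α`
arises from the polygons by gluing them along the arcs of `β`, so the connected components of
`dualGraphOver` correspond to those of the complement of `α`. Hence a spanning forest of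
`dualGraphOver` with the same components is what is sought: the complement of `α` has one component
if `α` is nonseparating, and exactly two otherwise.

The proof that two sides in `β` never form a corner is `not_consecutiveAt_of_subset_range`. In
smooth coordinates that straighten `α`, transversality makes a defining function of `α` change its
sign along `β`, and the intermediate value theorem does the rest; no form of the Jordan curve
theorem is needed.

The comparison of components (`reflTransGen_iff_subset`) and the bound by two
(`exists_componentsIn_compl_eq_pair`) rest on the notion `IsTwoSidedAt` of a set that locally has
two connected sides. A component of the complement that comes close to one point of a connected
two-sided piece is adherent to all of the piece; applied to an arc of `β` this identifies the two
ends of the dual edge, and applied to all of `α` it shows that at most two components exist.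
-/

/-! ### Spanning forests -/

namespace Graph

variable {V E : Type*}

lemma reflTransGen_adj_symm {G : Graph V E} {x y : V} (h : Relation.ReflTransGen G.Adj x y) :
    Relation.ReflTransGen G.Adj y x :=
  haveI : Std.Symm G.Adj := ⟨fun _ _ h ↦ h.symm⟩
  symm_of (Relation.ReflTransGen G.Adj) h

/-- A graph is a forest as soon as it carries a height function on the vertices such that every
edge joins vertices of different heights, and at most one edge descends from each vertex: in an
embedded loop, both edges at a highest vertex would descend from it. -/
lemma isForest_of_height (G : Graph V E) (d : V → ℕ)
    (hd : ∀ e x y, G.IsLink e x y → d x ≠ d y)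
    (hp : ∀ e e' x y y', G.IsLink e x y → G.IsLink e' x y' → d y < d x → d y' < d x → e = e') :
    G.IsForest := by
  rintro ⟨n, x, e, hn, hx, -, hinj, hl⟩
  obtain ⟨i, hi, hmax⟩ := (Finset.range n).exists_max_image (fun i ↦ d (x i))
    ⟨0, Finset.mem_range.2 hn⟩
  simp only [Finset.mem_range] at hi hmax
  have hmax' : ∀ j ≤ n, d (x j) ≤ d (x i) := by
    intro j hj
    rcases hj.lt_or_eq with h | rfl
    · exact hmax j h
    · rw [hx]; exact hmax 0 hn
  obtain ⟨j, hj, hji⟩ : ∃ j < n, x (j + 1) = x i ∧ (j = i → n = 1) := by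
    rcases i with _ | i
    · exact ⟨n - 1, by omega, by rw [Nat.sub_add_cancel hn, hx], by omega⟩
    · exact ⟨i, by omega, rfl, by omega⟩
  have hlj := (hl j hj).symm
  rw [hji.1] at hlj
  have h3 : j = i := hinj hj hi <| hp _ _ _ _ _ hlj (hl i hi)
    (lt_of_le_of_ne (hmax' j hj.le) (hd _ _ _ hlj).symm)
    (lt_of_le_of_ne (hmax' (i + 1) hi) (hd _ _ _ (hl i hi)).symm)
  obtain rfl := hji.2 h3
  have hl0 := hl 0 hn
  rw [zero_add, hx] at hl0
  exact hd _ _ _ hl0 rfl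

/-- Every multigraph has a spanning forest with the same connected components: fix a root in each
component and join every other vertex, by one edge, to a vertex closer to the root. -/
theorem exists_isSpanningSubgraph_isForest (G : Graph V E) :
    ∃ F : Graph V E, F.IsSpanningSubgraph G ∧ F.IsForest ∧
      ∀ x y, Relation.ReflTransGen F.Adj x y ↔ Relation.ReflTransGen G.Adj x y := by
  let s : Setoid V := ⟨Relation.ReflTransGen G.Adj, fun _ ↦ .refl,
    reflTransGen_adj_symm, fun h h' ↦ h.trans h'⟩
  let r : V → V := fun x ↦ (Quotient.mk s x).out
  have hr : ∀ x, Relation.ReflTransGen G.Adj (r x) x := fun x ↦ Quotient.mk_out (s := s) x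
  have hr' : ∀ x y, Relation.ReflTransGen G.Adj x y → r x = r y := fun x y h ↦
    congrArg Quotient.out (Quotient.sound (s := s) h)
  -- `R n x` says that `x` is joined to its root by a walk of length `n`.
  let R : ℕ → V → Prop := fun n ↦ Nat.rec (fun x ↦ r x = x) (fun _ Q x ↦ ∃ y, Q y ∧ G.Adj y x) n
  have hR : ∀ x, ∃ n, R n x := by
    have aux : ∀ ρ x, r ρ = ρ → Relation.ReflTransGen G.Adj ρ x → ∃ n, R n x := by
      intro ρ x hρ h
      induction h with
      | refl => exact ⟨0, hρ⟩
      | tail _ h ih => exact ih.imp' Nat.succ fun n hn ↦ ⟨_, hn, h⟩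
    exact fun x ↦ aux (r x) x (hr' _ _ (hr x)) (hr x)
  let d : V → ℕ := fun x ↦ sInf {n | R n x}
  have hRd : ∀ x, R (d x) x := fun x ↦ Nat.sInf_mem (hR x)
  have hdle : ∀ n x, R n x → d x ≤ n := fun n x h ↦ Nat.sInf_le h
  have hpar : ∀ x, d x ≠ 0 → ∃ e y, G.IsLink e x y ∧ d y + 1 = d x := by
    intro x hx
    obtain ⟨m, hm⟩ := Nat.exists_eq_succ_of_ne_zero hx
    have h : R (m + 1) x := by
      have := hRd x
      rwa [hm] at this
    obtain ⟨y, hy, e, he⟩ := h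
    refine ⟨e, y, he.symm, le_antisymm ?_ ?_⟩
    · rw [hm]; exact Nat.succ_le_succ (hdle _ _ hy)
    · exact hdle _ _ ⟨y, hRd y, e, he⟩
  choose p q hpq hdq using hpar
  let F := G.restrict {e | ∃ x hx, e = p x hx}
  have hF : ∀ e x y, F.IsLink e x y → d y ≤ d x → ∃ hx, d y + 1 = d x ∧ e = p x hx := by
    rintro e x y h hyx
    obtain ⟨⟨z, hz, rfl⟩, hl⟩ : e ∈ {e | ∃ x hx, e = p x hx} ∧ G.IsLink e x y := by
      simpa [F, Graph.restrict, and_comm] using h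
    have h1 := hdq z hz
    rcases hl.eq_and_eq_or_eq_and_eq (hpq z hz) with ⟨rfl, rfl⟩ | ⟨rfl, rfl⟩
    · exact ⟨hz, h1, rfl⟩
    · omega
  have hFG : F ≤ G := restrict_le
  have hroot : ∀ n x, d x = n → Relation.ReflTransGen F.Adj (r x) x := by
    intro n
    induction n with
    | zero =>
      intro x hx
      have : R 0 x := by
        have := hRd x
        rwa [hx] at this
      rw [show r x = x from this]
    | succ n ih =>
      intro x hx
      have h0 : d x ≠ 0 := by omega
      have hlink : F.IsLink (p x h0) x (q x h0) :=
        (restrict_isLink ..) ▸ ⟨⟨x, h0, rfl⟩, hpq x h0⟩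
      have := ih (q x h0) (by have := hdq x h0; omega)
      rw [hr' x (q x h0) (.single (hpq x h0).adj)]
      exact this.tail hlink.symm.adj
  refine ⟨F, ⟨hFG, rfl⟩, F.isForest_of_height d ?_ ?_, fun x y ↦ ⟨?_, fun h ↦ ?_⟩⟩
  · intro e x y h hxy
    obtain ⟨-, h, -⟩ := hF e x y h hxy.ge
    omega
  · intro e e' x y y' h h' hy hy'
    obtain ⟨_, -, rfl⟩ := hF e x y h hy.le
    obtain ⟨_, -, rfl⟩ := hF e' x y' h' hy'.le
    rfl
  · exact Relation.ReflTransGen.mono (fun _ _ h ↦ Adj.mono hFG h) x y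
  · have hx := reflTransGen_adj_symm (hroot _ x rfl)
    rw [hr' x y h] at hx
    exact hx.trans (hroot _ y rfl)

end Graph

/-! ### Components of the complement of a locally two-sided set -/

section TwoSided

variable {X : Type*} [TopologicalSpace X]

/-- The connected components of a set `F`, as subsets of the ambient space. -/
def componentsIn (F : Set X) : Set (Set X) :=
  {P | ∃ x ∈ F, P = connectedComponentIn F x}

/-- The set `Z` has locally two sides at `x`: in some neighbourhood of `x`, the complement of `Z`
is the union of two preconnected sets, both of which accumulate at all points of `Z`. The two sides
may lie in the same component of `Zᶜ`, and globally there need be no consistent choice of them. -/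
def IsTwoSidedAt (Z : Set X) (x : X) : Prop :=
  ∃ U ∈ 𝓝 x, ∃ H₁ H₂ : Set X, IsPreconnected H₁ ∧ IsPreconnected H₂ ∧
    U \ Z = H₁ ∪ H₂ ∧ U ∩ Z ⊆ closure H₁ ∧ U ∩ Z ⊆ closure H₂

variable {F Z : Set X} {P Q : Set X} {x : X}

lemma eq_connectedComponentIn_of_mem (hP : P ∈ componentsIn F) (hx : x ∈ P) :
    P = connectedComponentIn F x := by
  obtain ⟨y, -, rfl⟩ := hP
  exact connectedComponentIn_eq hx

lemma subset_of_mem_componentsIn (hP : P ∈ componentsIn F) : P ⊆ F := by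
  obtain ⟨y, -, rfl⟩ := hP
  exact connectedComponentIn_subset _ _

lemma isConnected_of_mem_componentsIn (hP : P ∈ componentsIn F) : IsConnected P := by
  obtain ⟨y, hy, rfl⟩ := hP
  exact isConnected_connectedComponentIn_iff.2 hy

lemma isOpen_of_mem_componentsIn [LocallyConnectedSpace X] (hF : IsOpen F)
    (hP : P ∈ componentsIn F) : IsOpen P := by
  obtain ⟨y, -, rfl⟩ := hP
  exact hF.connectedComponentIn

lemma eq_of_mem_componentsIn (hP : P ∈ componentsIn F) (hQ : Q ∈ componentsIn F)
    (hxP : x ∈ P) (hxQ : x ∈ Q) : P = Q :=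
  (eq_connectedComponentIn_of_mem hP hxP).trans (eq_connectedComponentIn_of_mem hQ hxQ).symm

lemma subset_of_mem_componentsIn_of_inter {H : Set X} (hP : P ∈ componentsIn F)
    (hH : IsPreconnected H) (hHF : H ⊆ F) (hx : x ∈ H) (hxP : x ∈ P) : H ⊆ P := by
  rw [eq_connectedComponentIn_of_mem hP hxP]
  exact hH.subset_connectedComponentIn hx hHF

/-- Near a two-sided point `x` of `Z`, a component of `Zᶜ` that comes close to `x` contains one of
the two sides, and hence is adherent to all nearby points of `Z`. -/
lemma IsTwoSidedAt.eventually_mem_closure (h : IsTwoSidedAt Z x) (hP : P ∈ componentsIn Zᶜ)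
    (hx : x ∈ closure P) : ∀ᶠ y in 𝓝 x, y ∈ Z → y ∈ closure P := by
  obtain ⟨U, hU, H₁, H₂, h₁, h₂, hUZ, hc₁, hc₂⟩ := h
  obtain ⟨z, hzU, hzP⟩ := mem_closure_iff_nhds.1 hx U hU
  have hz : z ∈ H₁ ∪ H₂ := hUZ ▸ ⟨hzU, subset_of_mem_componentsIn hP hzP⟩
  have hs : H₁ ∪ H₂ ⊆ Zᶜ := hUZ ▸ fun _ h ↦ h.2
  filter_upwards [hU] with y hyU hyZ
  rcases hz with hz | hz
  · exact closure_mono (subset_of_mem_componentsIn_of_inter hP h₁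
      (subset_union_left.trans hs) hz hzP) (hc₁ ⟨hyU, hyZ⟩)
  · exact closure_mono (subset_of_mem_componentsIn_of_inter hP h₂
      (subset_union_right.trans hs) hz hzP) (hc₂ ⟨hyU, hyZ⟩)

/-- The components of `Zᶜ` that contain the two sides of `Z` at `x` are the only ones that come
close to `x`. -/
lemma IsTwoSidedAt.exists_components (h : IsTwoSidedAt Z x) (hx : x ∈ Z) :
    ∃ P ∈ componentsIn Zᶜ, ∃ Q ∈ componentsIn Zᶜ,
      (∀ R ∈ componentsIn Zᶜ, x ∈ closure R ↔ R = P ∨ R = Q) ∧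
      ∀ᶠ y in 𝓝 x, ∀ R ∈ componentsIn Zᶜ, y ∈ closure R → R = P ∨ R = Q := by
  obtain ⟨U, hU, H₁, H₂, h₁, h₂, hUZ, hc₁, hc₂⟩ := h
  have hs : H₁ ∪ H₂ ⊆ Zᶜ := hUZ ▸ fun _ h ↦ h.2
  have hxU := mem_of_mem_nhds hU
  obtain ⟨a, ha⟩ : H₁.Nonempty := closure_nonempty_iff.1 ⟨x, hc₁ ⟨hxU, hx⟩⟩
  obtain ⟨b, hb⟩ : H₂.Nonempty := closure_nonempty_iff.1 ⟨x, hc₂ ⟨hxU, hx⟩⟩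
  have haZ := hs (Or.inl ha)
  have hbZ := hs (Or.inr hb)
  have hP := h₁.subset_connectedComponentIn ha (subset_union_left.trans hs)
  have hQ := h₂.subset_connectedComponentIn hb (subset_union_right.trans hs)
  have key : ∀ᶠ y in 𝓝 x, ∀ R ∈ componentsIn Zᶜ, y ∈ closure R →
      R = connectedComponentIn Zᶜ a ∨ R = connectedComponentIn Zᶜ b := by
    filter_upwards [eventually_eventually_nhds.2 hU] with y hyU R hR hy
    obtain ⟨z, hzU, hzR⟩ := mem_closure_iff_nhds.1 hy U hyU
    have hz : z ∈ H₁ ∪ H₂ := hUZ ▸ ⟨hzU, subset_of_mem_componentsIn hR hzR⟩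
    exact hz.imp (fun hz ↦ eq_of_mem_componentsIn hR ⟨a, haZ, rfl⟩ hzR (hP hz))
      (fun hz ↦ eq_of_mem_componentsIn hR ⟨b, hbZ, rfl⟩ hzR (hQ hz))
  refine ⟨_, ⟨a, haZ, rfl⟩, _, ⟨b, hbZ, rfl⟩, fun R hR ↦ ⟨key.self_of_nhds R hR, ?_⟩, key⟩
  rintro (rfl | rfl)
  · exact closure_mono hP (hc₁ ⟨hxU, hx⟩)
  · exact closure_mono hQ (hc₂ ⟨hxU, hx⟩)

lemma subset_closure_of_isTwoSidedAt {e : Set X} (he : IsPreconnected e) (heZ : e ⊆ Z)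
    (h : ∀ x ∈ e, IsTwoSidedAt Z x) (hP : P ∈ componentsIn Zᶜ) (hx : x ∈ e)
    (hxP : x ∈ closure P) : e ⊆ closure P := by
  intro y hy
  refine (he.induction₂ (fun x y ↦ x ∈ closure P ↔ y ∈ closure P) (fun x hx ↦ ?_)
    (fun _ _ _ _ _ _ h h' ↦ h.trans h') (fun _ _ _ _ h ↦ h.symm) hx hy).1 hxP
  by_cases hxP : x ∈ closure P
  · filter_upwards [self_mem_nhdsWithin,
      nhdsWithin_le_nhds ((h x hx).eventually_mem_closure hP hxP)] with y hy h'
    exact iff_of_true hxP (h' (heZ hy))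
  · filter_upwards [nhdsWithin_le_nhds (isClosed_closure.isOpen_compl.mem_nhds hxP)] with y hy
    exact iff_of_false hxP hy

/-- A connected piece of `Z` along which `Z` is two-sided has the same one or two components of `Zᶜ`
on its sides all along. -/
lemma exists_components_subset_closure_iff {e : Set X} (he : IsConnected e) (heZ : e ⊆ Z)
    (h : ∀ x ∈ e, IsTwoSidedAt Z x) :
    ∃ P ∈ componentsIn Zᶜ, ∃ Q ∈ componentsIn Zᶜ,
      ∀ R ∈ componentsIn Zᶜ, e ⊆ closure R ↔ R = P ∨ R = Q := by
  obtain ⟨x, hx⟩ := he.nonempty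
  obtain ⟨P, hP, Q, hQ, hPQ, -⟩ := (h x hx).exists_components (heZ hx)
  refine ⟨P, hP, Q, hQ, fun R hR ↦ ?_⟩
  rw [← hPQ R hR]
  exact ⟨fun h ↦ h hx, subset_closure_of_isTwoSidedAt he.isPreconnected heZ h hR hx⟩

/-- In a connected space, a connected closed set that is two-sided at each of its points has
at most two complementary components: all of them are adherent to all of `Z`. -/
lemma exists_componentsIn_compl_eq_pair [LocallyConnectedSpace X] [ConnectedSpace X]
    (hZ : IsConnected Z) (hZc : IsClosed Z) (h : ∀ x ∈ Z, IsTwoSidedAt Z x) :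
    ∃ P Q, componentsIn Zᶜ = {P, Q} := by
  obtain ⟨P, hP, Q, hQ, hPQ⟩ := exists_components_subset_closure_iff hZ subset_rfl h
  refine ⟨P, Q, Subset.antisymm (fun R hR ↦ (hPQ R hR).1 ?_) ?_⟩
  · by_contra hne
    have hdisj : closure R ⊆ Zᶜ := fun x hx hxZ ↦
      hne (subset_closure_of_isTwoSidedAt hZ.isPreconnected subset_rfl h hR hxZ hx)
    have hRc := isConnected_of_mem_componentsIn hR
    obtain ⟨x, hx⟩ := hRc.nonempty
    have hclosed : IsClosed R := isClosed_of_closure_subset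
      (subset_of_mem_componentsIn_of_inter hR hRc.isPreconnected.closure hdisj
        (subset_closure hx) hx)
    have huniv : R = univ := IsClopen.eq_univ
      ⟨hclosed, isOpen_of_mem_componentsIn hZc.isOpen_compl hR⟩ hRc.nonempty
    obtain ⟨z, hz⟩ := hZ.nonempty
    exact subset_of_mem_componentsIn hR (huniv ▸ mem_univ z) hz
  · rintro R (rfl | rfl) <;> assumption

end TwoSided

/-! ### Straightening smooth curves -/

namespace CurvePair

section Straightening

variable {S : Type*} [TopologicalSpace S] [ChartedSpace (EuclideanSpace ℝ (Fin 2)) S]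

/-- Near each of its points, a smoothly embedded circle is a line in suitable smooth coordinates. -/
lemma IsSimpleClosedCurve.exists_straightening {γ : C(Circle, S)} (hγ : IsSimpleClosedCurve γ)
    (z : Circle) :
    ∃ Φ ∈ IsManifold.maximalAtlas (𝓡 2) ∞ S, γ z ∈ Φ.source ∧
      ∃ l : EuclideanSpace ℝ (Fin 2) →L[ℝ] ℝ, Function.Surjective l ∧
        ∀ᶠ q in 𝓝 (γ z), q ∈ range γ ↔ l (Φ q) = 0 := by
  have him := hγ.isImmersion.isImmersionAt z
  set D := him.domChart
  set C := him.codChart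
  set φ := him.equiv
  have hzD : z ∈ D.source := him.mem_domChart_source
  have hzC : γ z ∈ C.source := him.mem_codChart_source
  have hwr : ∀ w ∈ D.source, C (γ w) = φ (D w, 0) := by
    intro w hw
    have hmem : D w ∈ (D.extend (𝓡 1)).target := by simpa using D.map_source hw
    have := him.writtenInCharts hmem
    have hl : him.domChart.symm (D w) = w := D.left_inv hw
    simpa [hl] using this
  have hfin : FiniteDimensional ℝ him.complement :=
    FiniteDimensional.of_injective (φ.toLinearMap.comp (LinearMap.inr ℝ _ _))
      (φ.injective.comp LinearMap.inr_injective)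
  have hrank : Module.finrank ℝ him.complement = Module.finrank ℝ ℝ := by
    have := φ.toLinearEquiv.finrank_eq
    simp only [Module.finrank_prod, finrank_euclideanSpace, Fintype.card_fin] at this
    simp only [Module.finrank_self]
    omega
  let ε : him.complement ≃L[ℝ] ℝ := ContinuousLinearEquiv.ofFinrankEq hrank
  refine ⟨C, him.codChart_mem_maximalAtlas, hzC, (ε : him.complement →L[ℝ] ℝ).comp
    ((ContinuousLinearMap.snd ℝ _ _).comp (φ.symm : EuclideanSpace ℝ (Fin 2) →L[ℝ]
      EuclideanSpace ℝ (Fin 1) × him.complement)), ?_, ?_⟩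
  · exact ε.surjective.comp (Prod.snd_surjective.comp φ.symm.surjective)
  · -- As `γ` is an embedding, no part of the curve outside the chart of the circle comes close
    -- to `γ z`.
    obtain ⟨W, hWo, hW⟩ := hγ.isEmbedding.isInducing.isOpen_iff.1 D.open_source
    have h1 : ∀ᶠ q in 𝓝 (γ z), q ∈ W := hWo.mem_nhds (by rw [← hW] at hzD; exact hzD)
    have h2 : ∀ᶠ q in 𝓝 (γ z), (φ.symm (C q)).1 ∈ D.target := by
      have hc : ContinuousAt (fun q ↦ (φ.symm (C q)).1) (γ z) :=
        continuous_fst.continuousAt.comp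
          (φ.symm.continuous.continuousAt.comp (C.continuousAt hzC))
      refine hc.eventually (D.open_target.mem_nhds ?_)
      beta_reduce
      rw [hwr z hzD, φ.symm_apply_apply]
      exact D.map_source hzD
    filter_upwards [h1, h2, C.open_source.mem_nhds hzC] with q hqW hqD hqC
    simp only [ContinuousLinearMap.comp_apply, ContinuousLinearEquiv.coe_coe,
      ContinuousLinearMap.coe_snd', map_eq_zero_iff ε ε.injective]
    constructor
    · rintro ⟨w, rfl⟩
      have hw : w ∈ D.source := by rw [← hW]; exact hqW
      rw [hwr w hw, φ.symm_apply_apply]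
    · intro h0
      have hs := D.map_target hqD
      refine ⟨D.symm (φ.symm (C q)).1, C.injOn (him.source_subset_preimage_source hs) hqC ?_⟩
      rw [hwr _ hs, D.right_inv hqD, ← h0, Prod.mk.eta, φ.apply_symm_apply]

/-- A smoothly embedded circle is locally two-sided, and so is every set that
agrees with it locally. -/
lemma IsSimpleClosedCurve.isTwoSidedAt {γ : C(Circle, S)} (hγ : IsSimpleClosedCurve γ) {x : S}
    (hx : x ∈ range γ) {Z : Set S} (hZ : ∀ᶠ q in 𝓝 x, q ∈ Z ↔ q ∈ range γ) :
    IsTwoSidedAt Z x := by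
  obtain ⟨z, rfl⟩ := hx
  obtain ⟨Φ, -, hzΦ, l, hl, hΦ⟩ := hγ.exists_straightening z
  have hev : ∀ᶠ v in 𝓝 (Φ (γ z)), v ∈ Φ.target ∧ (Φ.symm v ∈ Z ↔ l v = 0) := by
    have ht : Filter.Tendsto Φ.symm (𝓝 (Φ (γ z))) (𝓝 (γ z)) := Φ.tendsto_symm hzΦ
    filter_upwards [ht.eventually hZ, ht.eventually hΦ,
      Φ.open_target.mem_nhds (Φ.map_source hzΦ)] with v h1 h2 hv
    exact ⟨hv, h1.trans (h2.trans (by rw [Φ.right_inv hv]))⟩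
  obtain ⟨r, hr, hball⟩ := Metric.eventually_nhds_iff_ball.1 hev
  set K := Metric.ball (Φ (γ z)) r
  have hside : ∀ m : EuclideanSpace ℝ (Fin 2) →L[ℝ] ℝ, Function.Surjective m →
      IsPreconnected (Φ.symm '' (K ∩ m ⁻¹' Ioi 0)) ∧
      ∀ q ∈ Φ.source, Φ q ∈ K → m (Φ q) = 0 → q ∈ closure (Φ.symm '' (K ∩ m ⁻¹' Ioi 0)) := by
    intro m hm
    have hsub : K ∩ m ⁻¹' Ioi 0 ⊆ Φ.target := fun v hv ↦ (hball v hv.1).1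
    refine ⟨IsPreconnected.image (((convex_ball _ _).inter
      ((convex_Ioi (0 : ℝ)).linear_preimage m.toLinearMap)).isPreconnected) _
      (Φ.continuousOn_symm.mono hsub), fun q hq hqK hq0 ↦ ?_⟩
    have hcl : Φ q ∈ closure (K ∩ m ⁻¹' Ioi 0) := by
      refine Metric.isOpen_ball.inter_closure ⟨hqK, ?_⟩
      rw [← (m.isOpenMap hm).preimage_closure_eq_closure_preimage m.continuous, closure_Ioi]
      exact hq0.ge
    have := ((Φ.continuousAt_symm (Φ.map_source hq)).continuousWithinAt
      (s := K ∩ m ⁻¹' Ioi 0)).mem_closure_image hcl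
    rwa [Φ.left_inv hq] at this
  obtain ⟨hc1, hd1⟩ := hside l hl
  obtain ⟨hc2, hd2⟩ := hside (-l) (fun y ↦ (hl (-y)).imp fun a ha ↦ by simp [ha])
  have hiff : ∀ q ∈ Φ.source, Φ q ∈ K → (q ∈ Z ↔ l (Φ q) = 0) := fun q hq hqK ↦ by
    simpa [Φ.left_inv hq] using (hball _ hqK).2
  refine ⟨Φ.source ∩ Φ ⁻¹' K, (Φ.isOpen_inter_preimage Metric.isOpen_ball).mem_nhds
    ⟨hzΦ, Metric.mem_ball_self hr⟩, _, _, hc1, hc2, ?_, ?_, ?_⟩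
  · ext q
    constructor
    · rintro ⟨⟨hq, hqK⟩, hqZ⟩
      rw [hiff q hq hqK] at hqZ
      rcases lt_or_gt_of_ne hqZ with h | h
      · exact Or.inr ⟨Φ q, ⟨hqK, by simpa using h⟩, Φ.left_inv hq⟩
      · exact Or.inl ⟨Φ q, ⟨hqK, h⟩, Φ.left_inv hq⟩
    · rintro (⟨v, ⟨hvK, hv⟩, rfl⟩ | ⟨v, ⟨hvK, hv⟩, rfl⟩)
      all_goals
        obtain ⟨hvt, hvZ⟩ := hball v hvK
        refine ⟨⟨Φ.map_target hvt, by rwa [mem_preimage, Φ.right_inv hvt]⟩, fun h ↦ ?_⟩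
        simp [hvZ.1 h] at hv
  · exact fun q ⟨⟨hq, hqK⟩, hqZ⟩ ↦ hd1 q hq hqK ((hiff q hq hqK).1 hqZ)
  · exact fun q ⟨⟨hq, hqK⟩, hqZ⟩ ↦ hd2 q hq hqK (by simpa using (hiff q hq hqK).1 hqZ)

/-- If two curves cross transversely at `α z = β w`, then there is a local defining function `u`
of `α` that changes its sign along `β` at `w`. -/
lemma exists_sign_change [IsManifold (𝓡 2) ∞ S] {α β : C(Circle, S)} (hα : IsSimpleClosedCurve α)
    (hβ : IsSimpleClosedCurve β) (h : Transverse α β) {z w : Circle} (hzw : α z = β w) :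
    ∃ (u : S → ℝ) (χ : OpenPartialHomeomorph Circle ℝ) (c : ℝ), w ∈ χ.source ∧
      (∀ᶠ q in 𝓝 (β w), ContinuousAt u q ∧ (q ∈ range α ↔ u q = 0)) ∧
      ∀ᶠ t in 𝓝 w, χ t ≠ χ w → 0 < c * (χ t - χ w) * u (β t) := by
  obtain ⟨Φ, hΦ, hzΦ, l, hl, hu⟩ := hα.exists_straightening z
  rw [hzw] at hu hzΦ
  have hΦd : Φ.MDifferentiable (𝓡 2) (𝓡 2) :=
    ⟨(contMDiffOn_of_mem_maximalAtlas hΦ).mdifferentiableOn (by simp),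
      (contMDiffOn_symm_of_mem_maximalAtlas hΦ).mdifferentiableOn (by simp)⟩
  let A : EuclideanSpace ℝ (Fin 2) →L[ℝ] EuclideanSpace ℝ (Fin 2) := mfderiv (𝓡 2) (𝓡 2) Φ (β w)
  let L : EuclideanSpace ℝ (Fin 2) →L[ℝ] ℝ := l.comp A
  have hA : Function.Surjective A := by
    have : IsManifold (𝓡 2) 1 S := IsManifold.of_le (n := ∞) (by simp)
    exact hΦd.mfderiv_surjective hzΦ
  have hLs : Function.Surjective L := hl.comp hA
  have huL : HasMFDerivAt (𝓡 2) 𝓘(ℝ) (fun q ↦ l (Φ q)) (β w) L :=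
    HasMFDerivAt.comp (I' := 𝓡 2) (β w) l.hasFDerivAt.hasMFDerivAt
      (hΦd.mdifferentiableAt hzΦ).hasMFDerivAt
  have hαd : MDifferentiableAt (𝓡 1) (𝓡 2) α z :=
    (hα.contMDiff.contMDiffAt).mdifferentiableAt (by simp)
  have hβd : MDifferentiableAt (𝓡 1) (𝓡 2) β w :=
    (hβ.contMDiff.contMDiffAt).mdifferentiableAt (by simp)
  let a : EuclideanSpace ℝ (Fin 1) →L[ℝ] EuclideanSpace ℝ (Fin 2) := mfderiv (𝓡 1) (𝓡 2) α z
  let b : EuclideanSpace ℝ (Fin 1) →L[ℝ] EuclideanSpace ℝ (Fin 2) := mfderiv (𝓡 1) (𝓡 2) β w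
  have hLa : L.comp a = 0 := by
    have h1 : HasMFDerivAt (𝓡 1) 𝓘(ℝ) (fun t ↦ l (Φ (α t))) z (L.comp a) :=
      HasMFDerivAt.comp (I' := 𝓡 2) (g := fun q ↦ l (Φ q)) z (hzw ▸ huL) hαd.hasMFDerivAt
    have h2 : (fun t ↦ l (Φ (α t))) =ᶠ[𝓝 z] fun _ ↦ (0 : ℝ) := by
      have : ∀ᶠ t in 𝓝 z, α t ∈ range α ↔ l (Φ (α t)) = 0 :=
        α.continuous.continuousAt.eventually (by rw [hzw]; exact hu)
      filter_upwards [this] with t ht using ht.1 (mem_range_self t)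
    have h3 := (hasMFDerivAt_const (I := 𝓡 1) (I' := 𝓘(ℝ)) (0 : ℝ) z).congr_of_eventuallyEq h2
    exact hasMFDerivAt_unique h1 h3
  -- The derivative of `l ∘ Φ` kills the tangent line of `α`; by transversality, it would vanish if
  -- it killed that of `β` as well.
  have hLb : L.comp b ≠ 0 := by
    intro hLb
    have hker : (⊤ : Submodule ℝ (EuclideanSpace ℝ (Fin 2))) ≤ LinearMap.ker L.toLinearMap := by
      rw [← h z w hzw]
      refine sup_le ?_ ?_
      · rintro _ ⟨t, rfl⟩
        exact congrArg (fun f : EuclideanSpace ℝ (Fin 1) →L[ℝ] ℝ ↦ f t) hLa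
      · rintro _ ⟨t, rfl⟩
        exact congrArg (fun f : EuclideanSpace ℝ (Fin 1) →L[ℝ] ℝ ↦ f t) hLb
    obtain ⟨v, hv⟩ := hLs 1
    have : L v = 0 := hker (Submodule.mem_top (x := v))
    exact one_ne_zero (hv.symm.trans this)
  let κ : EuclideanSpace ℝ (Fin 1) ≃L[ℝ] ℝ := ContinuousLinearEquiv.ofFinrankEq (by simp)
  let θ := chartAt (EuclideanSpace ℝ (Fin 1)) w
  have hwθ : w ∈ θ.source := mem_chart_source _ w
  let χ : OpenPartialHomeomorph Circle ℝ := θ.transHomeomorph κ.toHomeomorph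
  have hθd : θ.MDifferentiable (𝓡 1) (𝓡 1) := mdifferentiable_chart w
  let τ : EuclideanSpace ℝ (Fin 1) →L[ℝ] EuclideanSpace ℝ (Fin 1) :=
    mfderiv (𝓡 1) (𝓡 1) θ.symm (θ w)
  have hτ : Function.Surjective τ := hθd.symm.mfderiv_surjective (θ.map_source hwθ)
  have hder : HasFDerivAt (fun s : ℝ ↦ l (Φ (β (θ.symm (κ.symm s)))))
      (((L.comp b).comp τ).comp (κ.symm : ℝ →L[ℝ] _)) (κ (θ w)) := by
    have h1 : HasMFDerivAt (𝓡 1) 𝓘(ℝ) (fun t ↦ l (Φ (β t))) w (L.comp b) :=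
      HasMFDerivAt.comp (I' := 𝓡 2) (g := fun q ↦ l (Φ q)) w huL hβd.hasMFDerivAt
    have h2 : HasMFDerivAt (𝓡 1) 𝓘(ℝ) (fun v ↦ l (Φ (β (θ.symm v)))) (θ w)
        ((L.comp b).comp τ) :=
      HasMFDerivAt.comp (I' := 𝓡 1) (g := fun t ↦ l (Φ (β t))) (θ w)
        (by rw [θ.left_inv hwθ]; exact h1)
        (hθd.mdifferentiableAt_symm (θ.map_source hwθ)).hasMFDerivAt
    have h3 : HasFDerivAt (fun v ↦ l (Φ (β (θ.symm v)))) ((L.comp b).comp τ) (θ w) :=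
      hasMFDerivAt_iff_hasFDerivAt.1 h2
    exact HasFDerivAt.comp (g := fun v ↦ l (Φ (β (θ.symm v)))) (κ (θ w))
      (by rw [κ.symm_apply_apply]; exact h3) κ.symm.hasFDerivAt
  set c : ℝ := (((L.comp b).comp τ).comp (κ.symm : ℝ →L[ℝ] _)) 1 with hc
  have hc0 : c ≠ 0 := by
    intro h0
    apply hLb
    ext v
    obtain ⟨v', rfl⟩ := hτ v
    have : v' = κ v' • κ.symm 1 := by
      rw [← map_smul, smul_eq_mul, mul_one, κ.symm_apply_apply]
    rw [this, map_smul, map_smul]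
    simpa [hc] using Or.inr h0
  have h0 : l (Φ (β w)) = 0 := hu.self_of_nhds.1 ⟨z, hzw⟩
  -- Near `w`, the difference quotient of `u` along `β` has the sign of the derivative `c`.
  have hslope := hasDerivAt_iff_tendsto_slope.1 hder.hasDerivAt
  have hpos : ∀ᶠ s in 𝓝[≠] (κ (θ w)),
      0 < c * slope (fun s : ℝ ↦ l (Φ (β (θ.symm (κ.symm s))))) (κ (θ w)) s :=
    (hslope.const_mul c).eventually (lt_mem_nhds (mul_self_pos.2 hc0))
  rw [eventually_nhdsWithin_iff] at hpos
  refine ⟨fun q ↦ l (Φ q), χ, c, by simpa [χ] using hwθ, ?_, ?_⟩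
  · filter_upwards [hu, Φ.open_source.mem_nhds hzΦ] with q hq hqΦ
    exact ⟨l.continuous.continuousAt.comp (Φ.continuousAt hqΦ), hq⟩
  · have hcont : Filter.Tendsto (fun t ↦ κ (θ t)) (𝓝 w) (𝓝 (κ (θ w))) :=
      κ.continuous.continuousAt.comp (θ.continuousAt hwθ)
    filter_upwards [hcont.eventually hpos, θ.open_source.mem_nhds hwθ] with t ht htθ hne
    change κ (θ t) ≠ κ (θ w) at hne
    change 0 < c * (κ (θ t) - κ (θ w)) * l (Φ (β t))
    have h1 := ht hne
    simp only [slope_def_field, κ.symm_apply_apply, θ.left_inv htθ, θ.left_inv hwθ, h0,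
      sub_zero] at h1
    have h2 : 0 < (κ (θ t) - κ (θ w)) ^ 2 := by
      have := sub_ne_zero.2 hne
      positivity
    have h3 := mul_pos h1 h2
    have h4 := sub_ne_zero.2 hne
    field_simp at h3
    linarith

end Straightening

end CurvePair

/-! ### Corners of the complementary polygons -/

namespace CurvePair

/-- Two continuous real functions that vanish at `0` and have the same sign at `ε` take a common
value at parameters that are not both `0`. -/
lemma exists_eq_of_same_sign {f g : ℝ → ℝ} {ε : ℝ} (hε : 0 < ε) (hf : ContinuousOn f (Icc 0 ε))
    (hg : ContinuousOn g (Icc 0 ε)) (hf0 : f 0 = 0) (hg0 : g 0 = 0) (h : 0 < f ε * g ε) :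
    ∃ s ∈ Ioc 0 ε, ∃ t ∈ Icc 0 ε, f s = g t := by
  have key : ∀ f g : ℝ → ℝ, ContinuousOn f (Icc 0 ε) → ContinuousOn g (Icc 0 ε) → f 0 = 0 →
      g 0 = 0 → 0 < f ε → 0 < g ε → ∃ s ∈ Ioc 0 ε, ∃ t ∈ Icc 0 ε, f s = g t := by
    intro f g hf hg hf0 hg0 hfε hgε
    have hm : 0 < min (f ε) (g ε) := lt_min hfε hgε
    obtain ⟨s, hs, hfs⟩ := intermediate_value_Icc hε.le hf
      ⟨hf0.symm ▸ hm.le, min_le_left (f ε) (g ε)⟩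
    obtain ⟨t, ht, hgt⟩ := intermediate_value_Icc hε.le hg
      ⟨hg0.symm ▸ hm.le, min_le_right (f ε) (g ε)⟩
    refine ⟨s, ⟨hs.1.lt_of_ne ?_, hs.2⟩, t, ht, hfs.trans hgt.symm⟩
    rintro rfl
    exact hm.ne' (hfs.symm.trans hf0)
  rcases pos_and_pos_or_neg_and_neg_of_mul_pos h with ⟨h1, h2⟩ | ⟨h1, h2⟩
  · exact key f g hf hg hf0 hg0 h1 h2
  · obtain ⟨s, hs, t, ht, hst⟩ := key (-f) (-g) hf.neg hg.neg (by simp [hf0]) (by simp [hg0])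
      (by simpa using h1) (by simpa using h2)
    exact ⟨s, hs, t, ht, neg_injective hst⟩

section Corner

variable {S : Type*} [TopologicalSpace S] [ChartedSpace (EuclideanSpace ℝ (Fin 2)) S]
  [IsManifold (𝓡 2) ∞ S] {α β : C(Circle, S)}

/-- The two sides of a polygon at a corner do not both run in `β`. If the two sides of the corner
leave the vertex along the same branch of `β`, then they overlap by the intermediate value theorem.
If they leave it along opposite branches, then a function that defines `α` locally has opposite
signs at their ends, so it vanishes on a path joining these ends inside the polygon, which
therefore meets `α`. -/
lemma not_consecutiveAt_of_subset_range (hα : IsSimpleClosedCurve α) (hβ : IsSimpleClosedCurve β)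
    (h : Transverse α β) {P e e' : Set S} (he : e ⊆ range β) (he' : e' ⊆ range β) :
    ¬ ConsecutiveAt α β P e e' := by
  rintro ⟨⟨x, -, rfl⟩, -, -, ψ, hψ, hinj, ⟨⟨z, hz⟩, ⟨w, hw⟩⟩, hψe, hψe', hψP⟩
  obtain ⟨u, χ, c, hwχ, hu, hsign⟩ := exists_sign_change hα hβ h (hz.trans hw.symm)
  have h0 : (0 : ℝ) ∈ Icc (0 : ℝ) 1 := ⟨le_rfl, zero_le_one⟩
  -- Parametrize the two sides of the corner by the parameter circle of `β`.
  have lift : ∀ k : ℝ → ℝ × ℝ, Continuous k → k 0 = (0, 0) →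
      (∀ t ∈ Icc (0 : ℝ) 1, k t ∈ Icc (0 : ℝ) 1 ×ˢ Icc (0 : ℝ) 1) →
      (∀ t ∈ Ioc (0 : ℝ) 1, ψ (k t) ∈ range β) →
      ∃ f : ℝ → Circle, ContinuousOn f (Icc 0 1) ∧ f 0 = w ∧ ∀ t ∈ Icc (0 : ℝ) 1,
        β (f t) = ψ (k t) := by
    intro k hk hk0 hkI hkβ
    have : ∀ t ∈ Icc (0 : ℝ) 1, ∃ s, β s = ψ (k t) := by
      intro t ht
      rcases ht.1.eq_or_lt with rfl | h
      · exact ⟨w, by rw [hk0, hw]⟩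
      · exact hkβ t ⟨h, ht.2⟩
    choose! f hf using this
    refine ⟨f, ?_, hβ.isEmbedding.injective ?_, hf⟩
    · rw [hβ.isEmbedding.isInducing.continuousOn_iff]
      exact (hψ.comp hk.continuousOn hkI).congr hf
    · rw [hf 0 h0, hk0, hw]
  obtain ⟨f, hfc, hf0, hf⟩ := lift (fun t ↦ (t, 0)) (by fun_prop) rfl (fun t ht ↦ ⟨ht, h0⟩)
    (fun t ht ↦ he (hψe t ht))
  obtain ⟨g, hgc, hg0, hg⟩ := lift (fun t ↦ (0, t)) (by fun_prop) rfl (fun t ht ↦ ⟨h0, ht⟩)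
    (fun t ht ↦ he' (hψe' t ht))
  -- A size of the corner for which all the local information is available.
  obtain ⟨ε, hε, hε1, hεf, hεg, hεψ⟩ : ∃ ε : ℝ, 0 < ε ∧ ε ≤ 1 ∧
      (∀ t ∈ Icc 0 ε, f t ∈ χ.source ∧
        (χ (f t) ≠ χ w → 0 < c * (χ (f t) - χ w) * u (β (f t)))) ∧
      (∀ t ∈ Icc 0 ε, g t ∈ χ.source ∧
        (χ (g t) ≠ χ w → 0 < c * (χ (g t) - χ w) * u (β (g t)))) ∧
      ∀ s ∈ Icc 0 ε, ∀ t ∈ Icc 0 ε, ContinuousAt u (ψ (s, t)) ∧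
        (ψ (s, t) ∈ range α ↔ u (ψ (s, t)) = 0) := by
    have hloc := (χ.open_source.eventually_mem hwχ).and hsign
    have hft : Filter.Tendsto f (𝓝[Icc 0 1] 0) (𝓝 w) := by rw [← hf0]; exact hfc 0 h0
    have hgt : Filter.Tendsto g (𝓝[Icc 0 1] 0) (𝓝 w) := by rw [← hg0]; exact hgc 0 h0
    have h1 := hft.eventually hloc
    have h2 := hgt.eventually hloc
    have h3 := (hψ (0, 0) ⟨h0, h0⟩).eventually (hw ▸ hu)
    rw [eventually_nhdsWithin_iff, Metric.eventually_nhds_iff] at h1 h2 h3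
    obtain ⟨r₁, hr₁, h1⟩ := h1
    obtain ⟨r₂, hr₂, h2⟩ := h2
    obtain ⟨r₃, hr₃, h3⟩ := h3
    obtain ⟨ε, hε, hlt⟩ := exists_between
      (lt_min (zero_lt_one' ℝ) (lt_min hr₁ (lt_min hr₂ hr₃)))
    simp only [lt_min_iff] at hlt
    obtain ⟨hlt0, hlt1, hlt2, hlt3⟩ := hlt
    have hI : ∀ t ∈ Icc 0 ε, t ∈ Icc (0 : ℝ) 1 := fun t ht ↦ ⟨ht.1, ht.2.trans hlt0.le⟩
    have hdist : ∀ t ∈ Icc 0 ε, dist t 0 ≤ ε := fun t ht ↦ by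
      rw [Real.dist_0_eq_abs, abs_of_nonneg ht.1]; exact ht.2
    refine ⟨ε, hε, hlt0.le, fun t ht ↦ h1 ((hdist t ht).trans_lt hlt1) (hI t ht),
      fun t ht ↦ h2 ((hdist t ht).trans_lt hlt2) (hI t ht),
      fun s hs t ht ↦ h3 ?_ ⟨hI s hs, hI t ht⟩⟩
    rw [Prod.dist_eq]
    exact (max_le (hdist s hs) (hdist t ht)).trans_lt hlt3
  have hI : ∀ t ∈ Icc 0 ε, t ∈ Icc (0 : ℝ) 1 := fun t ht ↦ ⟨ht.1, ht.2.trans hε1⟩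
  have hεε : ε ∈ Icc 0 ε := ⟨hε.le, le_rfl⟩
  have h0ε : (0 : ℝ) ∈ Icc 0 ε := ⟨le_rfl, hε.le⟩
  -- The sides share no point besides the vertex.
  have hdisj : ∀ s ∈ Ioc 0 ε, ∀ t ∈ Icc 0 ε, χ (f s) ≠ χ (g t) := by
    intro s hs t ht heq
    have hs' : s ∈ Icc 0 ε := ⟨hs.1.le, hs.2⟩
    have hfg := χ.injOn (hεf s hs').1 (hεg t ht).1 heq
    have hψψ : ψ (s, 0) = ψ (0, t) := by rw [← hf s (hI s hs'), ← hg t (hI t ht), hfg]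
    have := hinj ⟨hI s hs', h0⟩ ⟨h0, hI t ht⟩ hψψ
    exact hs.1.ne' (congrArg Prod.fst this)
  have hχfc : ContinuousOn (fun t ↦ χ (f t) - χ w) (Icc 0 ε) :=
    (χ.continuousOn.comp (hfc.mono hI) fun t ht ↦ (hεf t ht).1).sub continuousOn_const
  have hχgc : ContinuousOn (fun t ↦ χ (g t) - χ w) (Icc 0 ε) :=
    (χ.continuousOn.comp (hgc.mono hI) fun t ht ↦ (hεg t ht).1).sub continuousOn_const
  have hfne : χ (f ε) ≠ χ w := by
    have := hdisj ε ⟨hε, le_rfl⟩ 0 h0ε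
    rwa [hg0] at this
  have hgne : χ (g ε) ≠ χ w := by
    intro heq
    have hgw : g ε = g 0 := χ.injOn (hεg ε hεε).1 (hεg 0 h0ε).1 (by rw [heq, hg0])
    have hψψ : ψ (0, ε) = ψ (0, 0) := by rw [← hg ε (hI ε hεε), ← hg 0 h0, hgw]
    have := hinj ⟨h0, hI ε hεε⟩ ⟨h0, h0⟩ hψψ
    exact hε.ne' (congrArg Prod.snd this)
  rcases lt_or_gt_of_ne (mul_ne_zero (sub_ne_zero.2 hfne) (sub_ne_zero.2 hgne)) with hneg | hpos
  · -- Opposite branches: `u` has opposite signs at the ends of the segment from `(ε, 0)` to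
    -- `(0, ε)`.
    have h1 := (hεf ε hεε).2 hfne
    have h2 := (hεg ε hεε).2 hgne
    rw [hf ε (hI ε hεε)] at h1
    rw [hg ε (hI ε hεε)] at h2
    have hu0 : u (ψ (ε, 0)) * u (ψ (0, ε)) < 0 := by
      have h12 := mul_pos h1 h2
      have : c ^ 2 * ((χ (f ε) - χ w) * (χ (g ε) - χ w)) *
          (u (ψ (ε, 0)) * u (ψ (0, ε))) > 0 := by linarith
      by_contra! hcon
      have h3 : c ^ 2 * ((χ (f ε) - χ w) * (χ (g ε) - χ w)) ≤ 0 :=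
        mul_nonpos_of_nonneg_of_nonpos (sq_nonneg c) hneg.le
      exact absurd this (mul_nonpos_of_nonpos_of_nonneg h3 hcon).not_gt
    have hmem : ∀ τ ∈ Icc 0 ε, ε - τ ∈ Icc 0 ε := fun τ hτ ↦
      ⟨sub_nonneg.2 hτ.2, sub_le_self _ hτ.1⟩
    have hcont : ContinuousOn (fun τ ↦ u (ψ (ε - τ, τ))) (Icc 0 ε) := by
      intro τ hτ
      have hψτ : ContinuousWithinAt (fun τ ↦ ψ (ε - τ, τ)) (Icc 0 ε) τ :=
        (hψ (ε - τ, τ) ⟨hI _ (hmem τ hτ), hI τ hτ⟩).comp (f := fun τ : ℝ ↦ (ε - τ, τ))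
          (by fun_prop) fun σ hσ ↦ ⟨hI _ (hmem σ hσ), hI σ hσ⟩
      exact (hεψ _ (hmem τ hτ) τ hτ).1.comp_continuousWithinAt
        (f := fun τ ↦ ψ (ε - τ, τ)) hψτ
    obtain ⟨τ, hτ, hτ0⟩ : ∃ τ ∈ Icc 0 ε, u (ψ (ε - τ, τ)) = 0 := by
      have := intermediate_value_uIcc (a := 0) (b := ε) (by rwa [uIcc_of_le hε.le])
      simp only [sub_zero, sub_self, uIcc_of_le hε.le] at this
      refine this (mem_uIcc.2 ?_)
      rcases mul_neg_iff.1 hu0 with h | h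
      · exact Or.inr ⟨h.2.le, h.1.le⟩
      · exact Or.inl ⟨h.1.le, h.2.le⟩
    have hτ1 : τ ≠ 0 := by
      rintro rfl
      rw [sub_zero] at hτ0
      simp [hτ0] at hu0
    have hτ2 : ε - τ ≠ 0 := by
      intro hτε
      rw [hτε, show τ = ε by linarith] at hτ0
      simp [hτ0] at hu0
    have hτα := (hεψ _ (hmem τ hτ) τ hτ).2.2 hτ0
    have hτP := hψP (ε - τ) ⟨(hmem τ hτ).1.lt_of_ne' hτ2, (hI _ (hmem τ hτ)).2⟩ τ
      ⟨hτ.1.lt_of_ne' hτ1, (hI τ hτ).2⟩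
    exact connectedComponentIn_subset _ _ hτP (Or.inl hτα)
  · -- The same branch: the two sides overlap.
    obtain ⟨s, hs, t, ht, hst⟩ := exists_eq_of_same_sign hε hχfc hχgc (by simp [hf0])
      (by simp [hg0]) hpos
    exact hdisj s hs t ht (sub_left_injective hst)

end Corner

/-! ### The dual graph restricted to the arcs of one curve -/

section Dual

variable {S : Type*} [TopologicalSpace S] {α β : C(Circle, S)}

/-- The spanning subgraph of the dual graph that consists of the edges dual to arcs of `β`. It
describes how the polygons are glued along `β` to form the complement of `α`. -/
def dualGraphOver (α β : C(Circle, S)) : Graph (Set S) (Set S) :=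
  (dualGraph α β).restrict {e | e ⊆ range β}

lemma isLink_dualGraphOver {e P Q : Set S} :
    (dualGraphOver α β).IsLink e P Q ↔ e ⊆ range β ∧ (dualGraph α β).IsLink e P Q :=
  Iff.of_eq (Graph.restrict_isLink ..)

lemma isClosed_range_curve [T2Space S] (γ : C(Circle, S)) : IsClosed (range γ) :=
  (isCompact_range γ.continuous).isClosed

lemma subset_diff_of_mem_edges {e : Set S} (he : e ∈ edges α β) (heβ : e ⊆ range β) :
    e ⊆ range β \ range α := fun _ hx ↦
  ⟨heβ hx, fun hxα ↦ (subset_of_mem_componentsIn (F := _ \ _) he hx).2 ⟨hxα, heβ hx⟩⟩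

/-- An edge of `α ∪ β` that contains a point off `α` is an arc of `β`. -/
lemma subset_range_of_mem_edges [T2Space S] {e : Set S} {x : S} (he : e ∈ edges α β) (hx : x ∈ e)
    (hxα : x ∉ range α) : e ⊆ range β := by
  have hsub := subset_of_mem_componentsIn (F := _ \ _) he
  have hpre := (isConnected_of_mem_componentsIn (F := _ \ _) he).isPreconnected
  intro y hy
  by_contra hyβ
  obtain ⟨v, hv, hvα, hvβ⟩ := hpre _ _ (isClosed_range_curve α).isOpen_compl
    (isClosed_range_curve β).isOpen_compl
    (fun v hv ↦ not_and_or.1 (hsub hv).2) ⟨x, hx, hxα⟩ ⟨y, hy, hyβ⟩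
  rcases (hsub hv).1 with h | h
  · exact hvα h
  · exact hvβ h

lemma isOpen_compl_union [T2Space S] : IsOpen (range α ∪ range β)ᶜ :=
  ((isClosed_range_curve α).union (isClosed_range_curve β)).isOpen_compl

/-- A walk that crosses only arcs of `β` stays in one component of the complement of `α`. -/
lemma subset_of_reflTransGen {C P Q : Set S} (hC : C ∈ componentsIn (range α)ᶜ)
    (hPC : P ⊆ C) (h : Relation.ReflTransGen (dualGraphOver α β).Adj P Q) : Q ⊆ C := by
  induction h with
  | refl => exact hPC
  | @tail P Q _ h ih =>
    obtain ⟨e, he⟩ := h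
    obtain ⟨heβ, hee, hP, hQ, hR⟩ := isLink_dualGraphOver.1 he
    obtain ⟨x, hx⟩ := (isConnected_of_mem_componentsIn (F := _ \ _) hee).nonempty
    have hxα := (subset_diff_of_mem_edges hee heβ hx).2
    -- The union of two adjacent polygons and a point of their common side is connected.
    have haux : ∀ R ∈ faces α β, x ∈ closure R →
        IsConnected (insert x R) ∧ insert x R ⊆ (range α)ᶜ := fun R hRf hxR ↦
      ⟨(isConnected_of_mem_componentsIn hRf).subset_closure (subset_insert x R)
        (insert_subset hxR subset_closure), insert_subset hxα
        ((subset_of_mem_componentsIn hRf).trans (compl_subset_compl.2 subset_union_left))⟩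
    obtain ⟨hPc, hPα⟩ := haux P hP ((hR P hP).2 (Or.inl rfl) hx)
    obtain ⟨hQc, hQα⟩ := haux Q hQ ((hR Q hQ).2 (Or.inr rfl) hx)
    obtain ⟨p, hp⟩ := (isConnected_of_mem_componentsIn hP).nonempty
    have hxC : x ∈ C := subset_of_mem_componentsIn_of_inter hC hPc.isPreconnected hPα
      (mem_insert_of_mem x hp) (ih hp) (mem_insert x P)
    exact (subset_insert x Q).trans
      (subset_of_mem_componentsIn_of_inter hC hQc.isPreconnected hQα (mem_insert x Q) hxC)

lemma exists_component_superset {P : Set S} (hP : P ∈ faces α β) :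
    ∃ C ∈ componentsIn (range α)ᶜ, P ⊆ C := by
  obtain ⟨x, hx⟩ := (isConnected_of_mem_componentsIn hP).nonempty
  have hPα : P ⊆ (range α)ᶜ :=
    (subset_of_mem_componentsIn hP).trans (compl_subset_compl.2 subset_union_left)
  exact ⟨_, ⟨x, hPα hx, rfl⟩,
    (isConnected_of_mem_componentsIn hP).isPreconnected.subset_connectedComponentIn hx hPα⟩

variable [ChartedSpace (EuclideanSpace ℝ (Fin 2)) S]

/-- The graph `α ∪ β` is locally two-sided at the interior points of the arcs of `β`. -/
lemma isTwoSidedAt_union [T2Space S] (hβ : IsSimpleClosedCurve β) {x : S} (hxβ : x ∈ range β)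
    (hxα : x ∉ range α) : IsTwoSidedAt (range α ∪ range β) x := by
  refine hβ.isTwoSidedAt hxβ ?_
  filter_upwards [(isClosed_range_curve α).isOpen_compl.mem_nhds hxα] with q hq
  exact ⟨fun h ↦ h.resolve_left hq, Or.inr⟩

/-- The polygons adherent to a point off `α` are pairwise equal or joined by an arc of `β`, and no
further polygons are adherent to the nearby points. -/
lemma exists_faces_near [T2Space S] (hβ : IsSimpleClosedCurve β) {x : S} (hxα : x ∉ range α) :
    ∃ P Q, (P = Q ∨ (dualGraphOver α β).Adj P Q) ∧ P ∈ faces α β ∧ x ∈ closure P ∧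
      (∀ R ∈ faces α β, x ∈ closure R → R = P ∨ R = Q) ∧
      ∀ᶠ y in 𝓝 x, ∀ R ∈ faces α β, y ∈ closure R → R = P ∨ R = Q := by
  by_cases hxβ : x ∈ range β
  · obtain ⟨P, hP, Q, hQ, hPQ, hev⟩ :=
      (isTwoSidedAt_union hβ hxβ hxα).exists_components (Or.inr hxβ)
    refine ⟨P, Q, Or.inr ?_, hP, (hPQ P hP).2 (Or.inl rfl), fun R hR ↦ (hPQ R hR).1, hev⟩
    have hx : x ∈ (range α ∪ range β) \ (range α ∩ range β) := ⟨Or.inr hxβ, fun h ↦ hxα h.1⟩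
    set e := connectedComponentIn ((range α ∪ range β) \ (range α ∩ range β)) x
    have hee : e ∈ edges α β := ⟨x, hx, rfl⟩
    have hxe : x ∈ e := mem_connectedComponentIn hx
    have heβ := subset_range_of_mem_edges hee hxe hxα
    refine ⟨e, isLink_dualGraphOver.2 ⟨heβ, hee, hP, hQ, fun R hR ↦ ?_⟩⟩
    rw [← hPQ R hR]
    exact ⟨fun h ↦ h hxe, subset_closure_of_isTwoSidedAt isPreconnected_connectedComponentIn
      (heβ.trans subset_union_right) (fun y hy ↦ isTwoSidedAt_union hβ (heβ hy)
      (subset_diff_of_mem_edges hee heβ hy).2) hR hxe⟩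
  · have : LocallyConnectedSpace S :=
      ChartedSpace.locallyConnectedSpace (EuclideanSpace ℝ (Fin 2)) S
    have hx : x ∈ (range α ∪ range β)ᶜ := fun h ↦ h.elim hxα hxβ
    have hP : connectedComponentIn (range α ∪ range β)ᶜ x ∈ faces α β := ⟨x, hx, rfl⟩
    have hPo := isOpen_of_mem_componentsIn isOpen_compl_union hP
    have hxP := mem_connectedComponentIn hx
    have hev : ∀ y ∈ connectedComponentIn (range α ∪ range β)ᶜ x, ∀ R ∈ faces α β,
        y ∈ closure R → R = connectedComponentIn (range α ∪ range β)ᶜ x ∨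
          R = connectedComponentIn (range α ∪ range β)ᶜ x := by
      intro y hy R hR hyR
      obtain ⟨v, hvP, hvR⟩ := mem_closure_iff_nhds.1 hyR _ (hPo.mem_nhds hy)
      exact Or.inl (eq_of_mem_componentsIn hR hP hvR hvP)
    exact ⟨_, _, Or.inl rfl, hP, subset_closure hxP, hev x hxP,
      Filter.eventually_of_mem (hPo.mem_nhds hxP) hev⟩

/-- Two polygons in the same component of the complement of `α` are joined by a walk that crosses
only arcs of `β`. -/
lemma reflTransGen_of_subset [T2Space S] (hβ : IsSimpleClosedCurve β) {C P Q : Set S}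
    (hC : IsPreconnected C) (hCα : C ⊆ (range α)ᶜ) (hP : P ∈ faces α β) (hQ : Q ∈ faces α β)
    (hPC : P ⊆ C) (hQC : Q ⊆ C) : Relation.ReflTransGen (dualGraphOver α β).Adj P Q := by
  obtain ⟨x, hx⟩ := (isConnected_of_mem_componentsIn hP).nonempty
  obtain ⟨y, hy⟩ := (isConnected_of_mem_componentsIn hQ).nonempty
  refine hC.induction₂ (fun x y ↦ ∀ P ∈ faces α β, ∀ Q ∈ faces α β, x ∈ closure P →
    y ∈ closure Q → Relation.ReflTransGen (dualGraphOver α β).Adj P Q) ?_ ?_ ?_ (hPC hx) (hQC hy)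
    P hP Q hQ (subset_closure hx) (subset_closure hy)
  · intro x hx
    obtain ⟨P₀, Q₀, hadj, -, -, hx', hev⟩ := exists_faces_near hβ (hCα hx)
    have hgen : Relation.ReflTransGen (dualGraphOver α β).Adj P₀ Q₀ := by
      rcases hadj with rfl | h
      · exact .refl
      · exact .single h
    filter_upwards [nhdsWithin_le_nhds hev] with y hy P hP Q hQ hxP hyQ
    rcases hx' P hP hxP with rfl | rfl <;> rcases hy Q hQ hyQ with rfl | rfl
    · exact .refl
    · exact hgen
    · exact Graph.reflTransGen_adj_symm hgen
    · exact .refl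
  · intro x y z _ hy _ hxy hyz P hP Q hQ hxP hzQ
    obtain ⟨R, -, -, hR, hyR, -⟩ := exists_faces_near hβ (hCα hy)
    exact (hxy P hP R hR hxP hyR).trans (hyz R hR Q hQ hyR hzQ)
  · exact fun x y _ _ hxy P hP Q hQ hyP hxQ ↦
      Graph.reflTransGen_adj_symm (hxy Q hQ P hP hxQ hyP)

/-- Every component of the complement of `α` contains one of the polygons. -/
lemma exists_face_subset [T2Space S] (hβ : IsSimpleClosedCurve β) {C : Set S}
    (hC : C ∈ componentsIn (range α)ᶜ) : ∃ P ∈ faces α β, P ⊆ C := by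
  have : LocallyConnectedSpace S :=
    ChartedSpace.locallyConnectedSpace (EuclideanSpace ℝ (Fin 2)) S
  obtain ⟨x, hx⟩ := (isConnected_of_mem_componentsIn hC).nonempty
  obtain ⟨P, -, -, hP, hxP, -⟩ := exists_faces_near hβ (subset_of_mem_componentsIn hC hx)
  obtain ⟨v, hvC, hvP⟩ := mem_closure_iff_nhds.1 hxP C
    ((isOpen_of_mem_componentsIn (isClosed_range_curve α).isOpen_compl hC).mem_nhds hx)
  exact ⟨P, hP, subset_of_mem_componentsIn_of_inter hC
    (isConnected_of_mem_componentsIn hP).isPreconnected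
    ((subset_of_mem_componentsIn hP).trans (compl_subset_compl.2 subset_union_left)) hvP hvC⟩

/-- A walk in `dualGraphOver α β` starting at a polygon in the component `C` of the complement of
`α` reaches exactly the polygons in `C`. -/
lemma reflTransGen_iff_subset [T2Space S] (hβ : IsSimpleClosedCurve β) {C P Q : Set S}
    (hC : C ∈ componentsIn (range α)ᶜ) (hP : P ∈ faces α β) (hPC : P ⊆ C) :
    Relation.ReflTransGen (dualGraphOver α β).Adj P Q ↔ Q ∈ faces α β ∧ Q ⊆ C := by
  refine ⟨fun h ↦ ⟨?_, subset_of_reflTransGen hC hPC h⟩, fun h ↦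
    reflTransGen_of_subset hβ (isConnected_of_mem_componentsIn hC).isPreconnected
      (subset_of_mem_componentsIn hC) hP h.1 hPC h.2⟩
  rcases Relation.ReflTransGen.cases_tail h with rfl | ⟨R, -, e, he⟩
  · exact hP
  · exact (isLink_dualGraphOver.1 he).2.2.2.1

end Dual

end CurvePair

/-! ### The spread spanning forest -/

theorem mainTheorem4 {S : Type*} [TopologicalSpace S] [T2Space S] [CompactSpace S]
    [ConnectedSpace S] [ChartedSpace (EuclideanSpace ℝ (Fin 2)) S] [IsManifold (𝓡 2) ∞ S]
    (α β : C(Circle, S))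
    (hα : CurvePair.IsSimpleClosedCurve α) (hβ : CurvePair.IsSimpleClosedCurve β)
    (hmin : CurvePair.InMinimalPosition α β) (hfill : CurvePair.IsFilling α β) :
    (CurvePair.IsNonseparating α →
      ∃ T : Graph (Set S) (Set S),
        T.IsSpanningSubgraph (CurvePair.dualGraph α β) ∧ T.IsTree ∧
          CurvePair.IsSpread α β T) ∧
    (¬ CurvePair.IsNonseparating α →
      ∃ F : Graph (Set S) (Set S),
        F.IsSpanningSubgraph (CurvePair.dualGraph α β) ∧ F.IsForest ∧
          F.componentSets.encard = 2 ∧ CurvePair.IsSpread α β F) := by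
  open CurvePair in
  have : LocallyConnectedSpace S :=
    ChartedSpace.locallyConnectedSpace (EuclideanSpace ℝ (Fin 2)) S
  obtain ⟨F, hF, hforest, hreach⟩ := (dualGraphOver α β).exists_isSpanningSubgraph_isForest
  have hV : V(F) = faces α β := hF.vertexSet_eq
  have hspan : F.IsSpanningSubgraph (dualGraph α β) := ⟨hF.le.trans Graph.restrict_le, hV⟩
  have hspread : IsSpread α β F := by
    rintro P - e e' ⟨Q, he⟩ ⟨Q', he'⟩
    exact not_consecutiveAt_of_subset_range hα hβ hmin.1
      (isLink_dualGraphOver.1 (he.mono hF.le)).1 (isLink_dualGraphOver.1 (he'.mono hF.le)).1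
  have hiff : ∀ C ∈ componentsIn (range α)ᶜ, ∀ P ∈ faces α β, P ⊆ C → ∀ Q,
      Relation.ReflTransGen F.Adj P Q ↔ Q ∈ faces α β ∧ Q ⊆ C := fun C hC P hP hPC Q ↦
    (hreach P Q).trans (reflTransGen_iff_subset hβ hC hP hPC)
  refine ⟨fun hns ↦ ⟨F, hspan, ⟨hforest, ?_, ?_⟩, hspread⟩,
    fun hsep ↦ ⟨F, hspan, hforest, ?_, hspread⟩⟩
  · obtain ⟨x, hx⟩ := hns.nonempty
    obtain ⟨P, hP, -⟩ := exists_face_subset hβ ⟨x, hx, rfl⟩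
    exact ⟨P, hV ▸ hP⟩
  · rw [hV]
    intro P hP Q hQ
    have hC : ∀ R ∈ faces α β, R ⊆ (range α)ᶜ := fun R hR ↦
      (subset_of_mem_componentsIn hR).trans (compl_subset_compl.2 subset_union_left)
    exact (hreach P Q).2 (reflTransGen_of_subset hβ hns.isPreconnected subset_rfl hP hQ
      (hC P hP) (hC Q hQ))
  · have hrange : IsConnected (range α) := isConnected_range α.continuous
    obtain ⟨C, D, hCD⟩ := exists_componentsIn_compl_eq_pair hrange (isClosed_range_curve α)
      fun x hx ↦ hα.isTwoSidedAt hx (.of_forall fun _ ↦ Iff.rfl)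
    have hC : C ∈ componentsIn (range α)ᶜ := hCD ▸ Or.inl rfl
    have hD : D ∈ componentsIn (range α)ᶜ := hCD ▸ Or.inr rfl
    have hne : C ≠ D := by
      rintro rfl
      refine hsep ?_
      have : (range α)ᶜ = C := by
        refine Subset.antisymm (fun x hx ↦ ?_) (subset_of_mem_componentsIn hC)
        have : connectedComponentIn (range α)ᶜ x ∈ componentsIn (range α)ᶜ := ⟨x, hx, rfl⟩
        rw [hCD] at this
        have h : connectedComponentIn (range α)ᶜ x = C := this.elim id id
        exact h ▸ mem_connectedComponentIn hx
      rw [IsNonseparating, this]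
      exact isConnected_of_mem_componentsIn hC
    have hsets : F.componentSets =
        {{Q | Q ∈ faces α β ∧ Q ⊆ C}, {Q | Q ∈ faces α β ∧ Q ⊆ D}} := by
      ext K
      constructor
      · rintro ⟨P, hP, rfl⟩
        rw [hV] at hP
        obtain ⟨C', hC', hPC'⟩ := exists_component_superset hP
        have hK : {Q | Relation.ReflTransGen F.Adj P Q} = {Q | Q ∈ faces α β ∧ Q ⊆ C'} :=
          Set.ext (hiff C' hC' P hP hPC')
        rw [hK]
        rw [hCD] at hC'
        rcases hC' with rfl | rfl
        · exact Or.inl rfl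
        · exact Or.inr rfl
      · have key : ∀ C' ∈ componentsIn (range α)ᶜ,
            {Q | Q ∈ faces α β ∧ Q ⊆ C'} ∈ F.componentSets := by
          intro C' hC'
          obtain ⟨P, hP, hPC'⟩ := exists_face_subset hβ hC'
          exact ⟨P, hV ▸ hP, (Set.ext (hiff C' hC' P hP hPC')).symm⟩
        rintro (rfl | rfl)
        · exact key C hC
        · exact key D hD
    rw [hsets]
    refine encard_pair fun heq ↦ hne ?_
    obtain ⟨P, hP, hPC⟩ := exists_face_subset hβ hC
    have hPD : P ⊆ D := ((Set.ext_iff.1 heq P).1 ⟨hP, hPC⟩).2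
    obtain ⟨x, hx⟩ := (isConnected_of_mem_componentsIn hP).nonempty
    exact eq_of_mem_componentsIn hC hD (hPC hx) (hPD hx)
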